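/- Let $G$ be a totally disconnected, locally compact (t.d.l.c.) topological group with identity $e$, and let $H$ be a closed subgroup of $G$ of finite co-volume, that is, the coset space $G/H$ carries a nonzero finite regular Borel measure invariant under left translation by $G$. For $x\in G$ let $$s_G(x)=\min\{[xVx^{-1}:xVx^{-1}\cap V] : V\leq G \text{ a compact open subgroup}\}$$ be the scale of $x$, and let $$\mathsf{con}(x)=\{g\in G : x^n g x^{-n}\to e \text{ as } n\to\infty\}$$ be the contraction subgroup of $x$ in $G$. Then the following hold. 1. If $s_G(h)=1$ for every $h\in H$, then $G$ is uniscalar, that is, $s_G(x)=1$ for every $x\in G$. 2. If $\mathsf{con}(h)$ is closed in $G$ for every $h\in H$, then $\mathsf{con}(x)$ is closed in $G$ for every $x\in G$. 3. If $\mathsf{con}(h)=\{e\}$ for every $h\in H$, then $G$ is anisotropic, that is, $\mathsf{con}(x)=\{e\}$ for every $x\in G$. -/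

import Mathlib

namespace TDLC

open MeasureTheory Filter Topology

variable {G : Type*} [Group G]

/-- The conjugate subgroup `x V x⁻¹`. -/
def conjSubgroup (x : G) (V : Subgroup G) : Subgroup G :=
  V.map (MulAut.conj x).toMonoidHom

variable [TopologicalSpace G]

/-- The scale of `x`: the minimum of the indices `[x V x⁻¹ : x V x⁻¹ ∩ V]` over all compact open
subgroups `V` of `G`. (`A.relIndex B` is the index `[B : A ∩ B]`.) In a totally disconnected,
locally compact group compact open subgroups exist, and these indices are positive integers. -/
noncomputable def scale (x : G) : ℕ :=
  sInf {k : ℕ | ∃ V : Subgroup G, IsCompact (V : Set G) ∧ IsOpen (V : Set G) ∧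
    k = (conjSubgroup x V ⊓ V).relIndex (conjSubgroup x V)}

variable (G) in
/-- `G` is uniscalar if the scale function is identically equal to `1`. -/
def IsUniscalar : Prop := ∀ x : G, scale x = 1

/-- `H` has finite co-volume in `G` if `G ⧸ H`, with its Borel σ-algebra, carries a nonzero finite
regular Borel (that is, Radon) measure invariant under left translation by `G`. -/
def HasFiniteCovolume (H : Subgroup G) : Prop :=
  ∃ (_ : MeasurableSpace (G ⧸ H)) (_ : BorelSpace (G ⧸ H)) (μ : Measure (G ⧸ H)),
    IsFiniteMeasure μ ∧ μ.Regular ∧ μ ≠ 0 ∧ SMulInvariantMeasure G (G ⧸ H) μ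

variable [IsTopologicalGroup G]

/-- The contraction subgroup of `x`: all `g` with `x ^ n g x ^ (-n) → 1` as `n → ∞`. -/
def con (x : G) : Subgroup G where
  carrier := {g : G | Tendsto (fun n : ℕ => x ^ n * g * (x ^ n)⁻¹) atTop (𝓝 1)}
  one_mem' := by simpa using (tendsto_const_nhds : Tendsto (fun _ : ℕ => (1 : G)) atTop (𝓝 1))
  mul_mem' := by
    intro a b ha hb
    simpa [mul_assoc] using Tendsto.mul ha hb
  inv_mem' := by
    intro a ha
    simpa [mul_assoc] using Tendsto.inv ha

variable (G) in
/-- `G` is anisotropic if the contraction subgroup of each of its elements is trivial. -/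
def IsAnisotropic : Prop := ∀ x : G, con x = ⊥

end TDLC

/-!
Let `U` be a compact open subgroup, and put `U₊ = ⋂ i ≥ 0, xⁱ U x⁻ⁱ` and
`U₋ = ⋂ i ≥ 0, x⁻ⁱ U xⁱ`. By a theorem of Willis, `U` can be chosen tidy above for `x`, that is, with
`U = U₊ U₋` (`exists_isTidyAbove`); then `U` is tidy above for every `xᵐ`, `m ≥ 0`.

Poincaré recurrence for the translation by `x` on `G ⧸ H` gives `m ≥ 1` such that `H` meets
`U xᵐ U` (`HasFiniteCovolume.exists_pow_mem`). Tidiness allows an element `h` of this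
intersection to be conjugated step by step, first into `xᵐ U₊`, then into `xᵐ K`, where
`K = ⋂ i ∈ ℤ, xᵐⁱ U x⁻ᵐⁱ`; compactness of `U` provides the limits of the conjugating
elements (`IsTidyAbove.exists_conj_mem_bicore`). Here `K` is a compact subgroup normalized by `xᵐ`.

So some conjugate `y` of `h` differs from `xᵐ` by an element of a compact subgroup `K` normalized by
both. Then `yⁿ ∈ K xᵐⁿ` for all `n`, hence `con y = con (xᵐ) = con x`
(`con_eq_con_of_mem_normalized`, `con_pow`), and `con x` is a conjugate of `con h`. This gives the
statements on contraction subgroups. For the scale, `scale g = 1` means that `g V g⁻¹ ≤ V` for some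
compact open subgroup `V` (`scale_eq_one_iff`); such a `V` for `y` becomes one for `xᵐ` after
intersecting its conjugates under `K` (`scale_eq_one_of_mem_normalized`), and then one for `x` after
intersecting finitely many conjugates under powers of `x` (`scale_eq_one_of_pow`).
-/

namespace TDLC

open MeasureTheory Filter Topology
open scoped Pointwise

/-! ### Intersections of conjugates of a subgroup, and tidiness above -/

section Algebra

variable {G : Type*} [Group G]

theorem mem_conjSubgroup {x g : G} {V : Subgroup G} :
    g ∈ conjSubgroup x V ↔ x⁻¹ * g * x ∈ V := by
  simp only [conjSubgroup, Subgroup.mem_map]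
  constructor
  · rintro ⟨v, hv, rfl⟩
    simpa [mul_assoc] using hv
  · intro h
    exact ⟨_, h, by simp [mul_assoc]⟩

theorem coe_conjSubgroup (x : G) (V : Subgroup G) :
    (conjSubgroup x V : Set G) = (fun g => x⁻¹ * g * x) ⁻¹' V := by
  ext g
  exact mem_conjSubgroup

/-- The subgroup `⋂ i ≤ N, zⁱ U z⁻ⁱ`. -/
def truncCore (z : G) (U : Subgroup G) (N : ℕ) : Subgroup G :=
  ⨅ i ∈ Set.Iic N, conjSubgroup (z ^ i) U

/-- The subgroup `⋂ i ≥ 0, zⁱ U z⁻ⁱ`, usually written `U₊`; it satisfies `z⁻¹ U₊ z ≤ U₊`. The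
subgroup usually written `U₋` is `core z⁻¹ U`. -/
def core (z : G) (U : Subgroup G) : Subgroup G :=
  ⨅ i : ℕ, conjSubgroup (z ^ i) U

theorem mem_truncCore {z g : G} {U : Subgroup G} {N : ℕ} :
    g ∈ truncCore z U N ↔ ∀ i ≤ N, (z ^ i)⁻¹ * g * z ^ i ∈ U := by
  simp [truncCore, Subgroup.mem_iInf, mem_conjSubgroup]

theorem mem_core {z g : G} {U : Subgroup G} :
    g ∈ core z U ↔ ∀ i : ℕ, (z ^ i)⁻¹ * g * z ^ i ∈ U := by
  simp [core, Subgroup.mem_iInf, mem_conjSubgroup]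

theorem mem_truncCore_inv {z g : G} {U : Subgroup G} {N : ℕ} :
    g ∈ truncCore z⁻¹ U N ↔ ∀ i ≤ N, z ^ i * g * (z ^ i)⁻¹ ∈ U := by
  simp [mem_truncCore]

theorem mem_core_inv {z g : G} {U : Subgroup G} :
    g ∈ core z⁻¹ U ↔ ∀ i : ℕ, z ^ i * g * (z ^ i)⁻¹ ∈ U := by
  simp [mem_core]

theorem mem_core_iff_forall_truncCore {z g : G} {U : Subgroup G} :
    g ∈ core z U ↔ ∀ N, g ∈ truncCore z U N := by
  simp only [mem_core, mem_truncCore]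
  exact ⟨fun h N i _ => h i, fun h i => h i i le_rfl⟩

theorem truncCore_antitone (z : G) (U : Subgroup G) : Antitone (truncCore z U) := by
  intro m n hmn g hg
  rw [mem_truncCore] at hg ⊢
  exact fun i hi => hg i (hi.trans hmn)

theorem core_le (z : G) (U : Subgroup G) : core z U ≤ U := fun g hg => by
  simpa using mem_core.1 hg 0

theorem truncCore_le (z : G) (U : Subgroup G) (N : ℕ) : truncCore z U N ≤ U := fun g hg => by
  simpa using mem_truncCore.1 hg 0 (Nat.zero_le N)

theorem inv_mul_mul_mem_core {z g : G} {U : Subgroup G} (hg : g ∈ core z U) :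
    z⁻¹ * g * z ∈ core z U := by
  rw [mem_core] at hg ⊢
  intro i
  have := hg (i + 1)
  simpa [pow_succ', mul_assoc] using this

theorem mul_mul_inv_mem_core_inv {z g : G} {U : Subgroup G} (hg : g ∈ core z⁻¹ U) :
    z * g * z⁻¹ ∈ core z⁻¹ U := by
  simpa using inv_mul_mul_mem_core hg

theorem core_truncCore (z : G) (U : Subgroup G) (N : ℕ) :
    core z (truncCore z U N) = core z U := by
  ext g
  simp only [mem_core, mem_truncCore]
  constructor
  · intro h i
    simpa using h i 0 (Nat.zero_le N)
  · intro h i j _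
    have := h (i + j)
    simpa [pow_add, mul_assoc] using this

theorem core_le_core_pow (z : G) (U : Subgroup G) (m : ℕ) : core z U ≤ core (z ^ m) U := by
  intro g hg
  rw [mem_core] at hg ⊢
  intro i
  simpa [← pow_mul] using hg (m * i)

/-- `U` is tidy above for `z`: `U = U₊ U₋`. -/
def IsTidyAbove (z : G) (U : Subgroup G) : Prop :=
  ∀ u ∈ U, ∃ p ∈ core z U, ∃ q ∈ core z⁻¹ U, u = p * q

theorem IsTidyAbove.pow {z : G} {U : Subgroup G} (h : IsTidyAbove z U) (m : ℕ) :
    IsTidyAbove (z ^ m) U := by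
  intro u hu
  obtain ⟨p, hp, q, hq, rfl⟩ := h u hu
  refine ⟨p, core_le_core_pow z U m hp, q, ?_, rfl⟩
  rw [← inv_pow]
  exact core_le_core_pow z⁻¹ U m hq

/-- The subgroup `U₊ ∩ U₋ = ⋂ i ∈ ℤ, zⁱ U z⁻ⁱ`, the largest subgroup of `U` normalized by `z`. -/
def bicore (z : G) (U : Subgroup G) : Subgroup G := core z U ⊓ core z⁻¹ U

theorem bicore_le (z : G) (U : Subgroup G) : bicore z U ≤ U := inf_le_left.trans (core_le z U)

theorem mul_mul_inv_mem_bicore {z g : G} {U : Subgroup G} (hg : g ∈ bicore z U) :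
    z * g * z⁻¹ ∈ bicore z U := by
  refine ⟨?_, mul_mul_inv_mem_core_inv hg.2⟩
  have h1 := mem_core.1 hg.1
  refine mem_core.2 fun i => ?_
  cases i with
  | zero => simpa using mem_core_inv.1 hg.2 1
  | succ i => simpa [pow_succ', mul_assoc] using h1 i

/-- If `U` is covered by `U₊ (z⁻¹ U z)`, the same holds with `z⁻¹ U z` replaced by the intersection
of any number of the subgroups `z⁻ⁱ U zⁱ`. -/
theorem exists_mul_truncCore_inv {z : G} {U : Subgroup G}
    (h : ∀ u ∈ U, ∃ p ∈ core z U, z * (p⁻¹ * u) * z⁻¹ ∈ U) (N : ℕ) :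
    ∀ u ∈ U, ∃ p ∈ core z U, p⁻¹ * u ∈ truncCore z⁻¹ U N := by
  induction N with
  | zero =>
    intro u hu
    exact ⟨1, one_mem _, mem_truncCore_inv.2 fun i hi => by simpa [Nat.le_zero.1 hi] using hu⟩
  | succ N ih =>
    intro u hu
    obtain ⟨p, hp, hpu⟩ := h u hu
    obtain ⟨p', hp', hq⟩ := ih _ hpu
    have hp'' := inv_mul_mul_mem_core hp'
    refine ⟨p * (z⁻¹ * p' * z), mul_mem hp hp'', mem_truncCore_inv.2 fun i hi => ?_⟩
    cases i with
    | zero =>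
      have h1 : p * (z⁻¹ * p' * z) ∈ U := core_le z U (mul_mem hp hp'')
      simpa using mul_mem (inv_mem h1) hu
    | succ i =>
      have := mem_truncCore_inv.1 hq i (by omega)
      simpa [pow_succ, mul_assoc] using this

/-- Conjugating by elements of `U`, an element of `U z U` can be moved into
`z (⋂ i ≤ N, zⁱ U z⁻ⁱ)`. -/
theorem IsTidyAbove.exists_conj_mem_truncCore {z : G} {U : Subgroup G} (h : IsTidyAbove z U)
    {a b : G} (ha : a ∈ U) (hb : b ∈ U) (N : ℕ) :
    ∃ t ∈ U, z⁻¹ * (t * (a * z * b) * t⁻¹) ∈ truncCore z U N := by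
  induction N with
  | zero =>
    refine ⟨a⁻¹, inv_mem ha, mem_truncCore.2 fun i hi => ?_⟩
    simpa [Nat.le_zero.1 hi, mul_assoc] using mul_mem hb ha
  | succ N ih =>
    obtain ⟨t, ht, hg⟩ := ih
    obtain ⟨p, hp, q, hq, hpq⟩ := h _ (inv_mem (truncCore_le _ _ _ hg))
    -- Write the element as `z q⁻¹ p⁻¹` and move the factor `q⁻¹` to the right-hand end.
    have hy : t * (a * z * b) * t⁻¹ = z * (q⁻¹ * p⁻¹) := by
      rw [← mul_inv_rev, ← hpq]; group
    have hq' : q⁻¹ ∈ truncCore z U N := by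
      have hpN := mem_core_iff_forall_truncCore.1 hp N
      have : q⁻¹ = (z⁻¹ * (t * (a * z * b) * t⁻¹)) * p := by rw [hy]; group
      rw [this]
      exact mul_mem hg hpN
    have hs := mul_mul_inv_mem_core_inv (inv_mem hq)
    refine ⟨(z * q⁻¹ * z⁻¹)⁻¹ * t, mul_mem (inv_mem (core_le _ _ hs)) ht, ?_⟩
    have hz : z⁻¹ * ((z * q⁻¹ * z⁻¹)⁻¹ * t * (a * z * b) * ((z * q⁻¹ * z⁻¹)⁻¹ * t)⁻¹)
        = p⁻¹ * (z * q⁻¹ * z⁻¹) := by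
      calc _ = z⁻¹ * ((z * q⁻¹ * z⁻¹)⁻¹ * (t * (a * z * b) * t⁻¹) * (z * q⁻¹ * z⁻¹)) := by group
        _ = _ := by rw [hy]; group
    rw [hz]
    refine mul_mem (mem_core_iff_forall_truncCore.1 (inv_mem hp) _) (mem_truncCore.2 fun i hi => ?_)
    cases i with
    | zero => simpa using core_le _ _ hs
    | succ i => simpa [pow_succ', mul_assoc] using mem_truncCore.1 hq' i (by omega)

/-- Conjugating by elements of `U₊`, an element of `z U₊` can be moved into `z (z⁻ᴺ U₊ zᴺ)`. -/
theorem exists_conj_pow_mul_mem_core {z y : G} {U : Subgroup G} (hy : z⁻¹ * y ∈ core z U) (N : ℕ) :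
    ∃ t ∈ U, z ^ N * (z⁻¹ * (t * y * t⁻¹)) * (z ^ N)⁻¹ ∈ core z U := by
  suffices ∃ t ∈ U, z ^ N * (z⁻¹ * (t * y * t⁻¹)) * (z ^ N)⁻¹ ∈ core z U ∧
      z⁻¹ * (t * y * t⁻¹) ∈ core z U by
    obtain ⟨t, ht, h, -⟩ := this
    exact ⟨t, ht, h⟩
  induction N with
  | zero => exact ⟨1, one_mem _, by simpa using hy, by simpa using hy⟩
  | succ N ih =>
    obtain ⟨t, ht, h1, h2⟩ := ih
    set g := z⁻¹ * (t * y * t⁻¹) with hg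
    have key : z⁻¹ * (g * t * y * (g * t)⁻¹) = z⁻¹ * g * z := by
      rw [hg]; group
    refine ⟨g * t, mul_mem (core_le _ _ h2) ht, ?_, ?_⟩
    · rw [key]
      simpa [pow_succ, mul_assoc] using h1
    · rw [key]
      exact inv_mul_mul_mem_core h2

end Algebra

/-! ### Existence of tidy above subgroups, and conjugation into a normalized coset -/

section Topological

variable {G : Type*} [Group G] [TopologicalSpace G] [IsTopologicalGroup G]

theorem isOpen_conjSubgroup (x : G) {V : Subgroup G} (hV : IsOpen (V : Set G)) :
    IsOpen (conjSubgroup x V : Set G) := by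
  rw [coe_conjSubgroup]
  exact hV.preimage (by fun_prop)

theorem isClosed_conjSubgroup (x : G) {V : Subgroup G} (hV : IsClosed (V : Set G)) :
    IsClosed (conjSubgroup x V : Set G) := by
  rw [coe_conjSubgroup]
  exact hV.preimage (by fun_prop)

theorem isCompact_conjSubgroup (x : G) {V : Subgroup G} (hV : IsCompact (V : Set G)) :
    IsCompact (conjSubgroup x V : Set G) := by
  have : (conjSubgroup x V : Set G) = (fun g => x * g * x⁻¹) '' V := by
    ext g
    simp [conjSubgroup]
  rw [this]
  exact hV.image (by fun_prop)

theorem isClosed_core (z : G) {U : Subgroup G} (hU : IsClosed (U : Set G)) :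
    IsClosed (core z U : Set G) := by
  rw [core, Subgroup.coe_iInf]
  exact isClosed_iInter fun i => isClosed_conjSubgroup _ hU

theorem isClosed_truncCore (z : G) {U : Subgroup G} (hU : IsClosed (U : Set G)) (N : ℕ) :
    IsClosed (truncCore z U N : Set G) := by
  simp only [truncCore, Subgroup.coe_iInf]
  exact isClosed_biInter fun i _ => isClosed_conjSubgroup _ hU

theorem isOpen_truncCore (z : G) {U : Subgroup G} (hU : IsOpen (U : Set G)) (N : ℕ) :
    IsOpen (truncCore z U N : Set G) := by
  simp only [truncCore, Subgroup.coe_iInf]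
  exact (Set.finite_Iic N).isOpen_biInter fun i _ => isOpen_conjSubgroup _ hU

theorem isClosed_bicore (z : G) {U : Subgroup G} (hU : IsClosed (U : Set G)) :
    IsClosed (bicore z U : Set G) :=
  (isClosed_core z hU).inter (isClosed_core z⁻¹ hU)

theorem exists_forall_mem_of_antitone {X Y : Type*} [TopologicalSpace X] [TopologicalSpace Y]
    {K : Set X} (hK : IsCompact K) (hKc : IsClosed K) {f : X → Y} (hf : Continuous f)
    {S : ℕ → Set Y} (hS : Antitone S) (hSc : ∀ n, IsClosed (S n))
    (h : ∀ n, ∃ t ∈ K, f t ∈ S n) : ∃ t ∈ K, ∀ n, f t ∈ S n := by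
  obtain ⟨t, ht⟩ := IsCompact.nonempty_iInter_of_sequence_nonempty_isCompact_isClosed
    (fun n => K ∩ f ⁻¹' S n)
    (fun n => Set.inter_subset_inter_right _ (Set.preimage_mono (hS n.le_succ)))
    (fun n => h n) (hK.inter_right ((hSc 0).preimage hf))
    (fun n => hKc.inter ((hSc n).preimage hf))
  rw [Set.mem_iInter] at ht
  exact ⟨t, (ht 0).1, fun n => (ht n).2⟩

theorem eventually_forall_conj_mem {K : Set G} (hK : IsCompact K) {O : Set G} (hO : O ∈ 𝓝 (1 : G)) :
    ∀ᶠ g in 𝓝 (1 : G), ∀ c ∈ K, c * g * c⁻¹ ∈ O := by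
  refine hK.eventually_forall_of_forall_eventually fun c _ => ?_
  have : Tendsto (fun p : G × G => p.2 * p.1 * p.2⁻¹) (𝓝 (1, c)) (𝓝 1) := by
    have h : Continuous fun p : G × G => p.2 * p.1 * p.2⁻¹ := by fun_prop
    simpa using h.tendsto (1, c)
  exact this hO

/-- Van Dantzig's theorem: the left stabilizer of a compact open neighbourhood of `1` is a compact
open subgroup. -/
theorem exists_compact_open_subgroup [LocallyCompactSpace G] [TotallyDisconnectedSpace G] :
    ∃ V : Subgroup G, IsCompact (V : Set G) ∧ IsOpen (V : Set G) := by
  obtain ⟨C, hC, hC1⟩ := exists_compact_mem_nhds (1 : G)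
  obtain ⟨W, hW, h1W, hWC⟩ := loc_compact_Haus_tot_disc_of_zero_dim.mem_nhds_iff.1 hC1
  have hWc : IsCompact W := hC.of_isClosed_subset hW.1 hWC
  have hev : ∀ᶠ g in 𝓝 (1 : G), ∀ w ∈ W, g * w ∈ W := by
    refine hWc.eventually_forall_of_forall_eventually fun w hw => ?_
    have : Tendsto (fun p : G × G => p.1 * p.2) (𝓝 (1, w)) (𝓝 w) := by
      simpa using (continuous_mul (M := G)).tendsto (1, w)
    exact this (hW.2.mem_nhds hw)
  have hinv : ∀ᶠ g in 𝓝 (1 : G), ∀ w ∈ W, g⁻¹ * w ∈ W :=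
    (continuous_inv.tendsto' (1 : G) 1 inv_one).eventually hev
  let V : Subgroup G :=
    { carrier := {g | ∀ w, g * w ∈ W ↔ w ∈ W}
      one_mem' := by simp
      mul_mem' := fun {a b} ha hb w => by rw [mul_assoc, ha, hb]
      inv_mem' := fun {a} ha w => by rw [← ha, mul_inv_cancel_left] }
  have hVo : IsOpen (V : Set G) := by
    refine V.isOpen_of_mem_nhds (g := 1) ?_
    filter_upwards [hev, hinv] with g hg hg' w
    exact ⟨fun h => by simpa using hg' _ h, hg w⟩
  refine ⟨V, hWc.of_isClosed_subset (V.isClosed_of_isOpen hVo) fun g hg => ?_, hVo⟩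
  simpa using (hg 1).2 h1W

/-- Willis: every element has a compact open subgroup that is tidy above for it, namely
`⋂ i ≤ N, zⁱ V z⁻ⁱ` for any compact open `V` and large `N`. -/
theorem exists_isTidyAbove [LocallyCompactSpace G] [TotallyDisconnectedSpace G] (z : G) :
    ∃ U : Subgroup G, IsCompact (U : Set G) ∧ IsOpen (U : Set G) ∧ IsTidyAbove z U := by
  obtain ⟨V, hVc, hVo⟩ := exists_compact_open_subgroup (G := G)
  have hVcl := V.isClosed_of_isOpen hVo
  -- The open set `V₊ (z⁻¹ V z)` contains `V₊ = ⋂ i, zⁱ V z⁻ⁱ`, hence one of the finite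
  -- intersections.
  obtain ⟨N, hN⟩ : ∃ N, (truncCore z V N : Set G) ⊆
      {u | ∃ p ∈ core z V, p⁻¹ * u ∈ conjSubgroup z⁻¹ V} := by
    have hanti : Antitone fun n => (truncCore z V n : Set G) := truncCore_antitone z V
    refine exists_subset_nhds_of_isCompact hanti.directed_ge
      (fun n => hVc.of_isClosed_subset (isClosed_truncCore z hVcl n) (truncCore_le z V n))
      fun u hu => ?_
    have hu' : u ∈ core z V := mem_core_iff_forall_truncCore.2 fun n => Set.mem_iInter.1 hu n
    have h1 : (conjSubgroup z⁻¹ V : Set G) ∈ 𝓝 (u⁻¹ * u) := by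
      rw [inv_mul_cancel]
      exact (isOpen_conjSubgroup z⁻¹ hVo).mem_nhds (one_mem _)
    have h2 : Continuous fun v : G => u⁻¹ * v := by fun_prop
    filter_upwards [h2.continuousAt.preimage_mem_nhds h1] with v hv
    exact ⟨u, hu', hv⟩
  have hUo := isOpen_truncCore z hVo N
  have hUcl := isClosed_truncCore z hVcl N
  have hUc := hVc.of_isClosed_subset hUcl (truncCore_le z V N)
  refine ⟨truncCore z V N, hUc, hUo, fun u hu => ?_⟩
  have hcov : ∀ u ∈ truncCore z V N, ∃ p ∈ core z (truncCore z V N),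
      z * (p⁻¹ * u) * z⁻¹ ∈ truncCore z V N := by
    intro u hu
    obtain ⟨p, hp, hq⟩ := hN hu
    refine ⟨p, by rwa [core_truncCore], mem_truncCore.2 fun i hi => ?_⟩
    cases i with
    | zero => simpa [mem_conjSubgroup] using hq
    | succ i =>
      have := mem_truncCore.1 (mul_mem (inv_mem (mem_core_iff_forall_truncCore.1 hp N)) hu) i
        (by omega)
      simpa [pow_succ', mul_assoc] using this
  have hcl := isClosed_core z hUcl
  obtain ⟨p, hp, hpu⟩ := exists_forall_mem_of_antitone
    (hUc.of_isClosed_subset hcl (core_le _ _)) hcl (f := fun p => p⁻¹ * u) (by fun_prop)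
    (S := fun n => (truncCore z⁻¹ (truncCore z V N) n : Set G))
    (truncCore_antitone z⁻¹ (truncCore z V N)) (fun n => isClosed_truncCore _ hUcl n)
    (fun n => exists_mul_truncCore_inv hcov n u hu)
  exact ⟨p, hp, p⁻¹ * u, mem_core_iff_forall_truncCore.2 hpu, by group⟩

/-- If `U` is tidy above for `z`, every element of `U z U` is conjugate under `U` to an element of
`z (⋂ i ∈ ℤ, zⁱ U z⁻ⁱ)`. -/
theorem IsTidyAbove.exists_conj_mem_bicore {z : G} {U : Subgroup G} (h : IsTidyAbove z U)
    (hUc : IsCompact (U : Set G)) (hUcl : IsClosed (U : Set G)) {a b : G} (ha : a ∈ U)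
    (hb : b ∈ U) : ∃ t, z⁻¹ * (t * (a * z * b) * t⁻¹) ∈ bicore z U := by
  obtain ⟨t, -, ht⟩ := exists_forall_mem_of_antitone hUc hUcl
    (f := fun t => z⁻¹ * (t * (a * z * b) * t⁻¹)) (by fun_prop)
    (S := fun n => (truncCore z U n : Set G)) (truncCore_antitone z U)
    (fun n => isClosed_truncCore z hUcl n) (fun n => h.exists_conj_mem_truncCore ha hb n)
  replace ht := mem_core_iff_forall_truncCore.2 ht
  set y := t * (a * z * b) * t⁻¹ with hy
  obtain ⟨s, -, hs⟩ := exists_forall_mem_of_antitone hUc hUcl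
    (f := fun s => z⁻¹ * (s * y * s⁻¹)) (by fun_prop)
    (S := fun n => (fun g => z ^ n * g * (z ^ n)⁻¹) ⁻¹' (core z U : Set G))
    (antitone_nat_of_succ_le fun n g hg => by
      have := inv_mul_mul_mem_core hg
      simpa [pow_succ', mul_assoc] using this)
    (fun n => (isClosed_core z hUcl).preimage (by fun_prop))
    (fun n => exists_conj_pow_mul_mem_core ht n)
  refine ⟨s * t, ?_⟩
  have : s * t * (a * z * b) * (s * t)⁻¹ = s * y * s⁻¹ := by rw [hy]; group
  rw [this]
  exact ⟨by simpa using hs 0, mem_core_inv.2 fun i => core_le _ _ (hs i)⟩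

/-! ### Contraction subgroups -/

theorem mem_con {x g : G} :
    g ∈ con x ↔ Tendsto (fun n : ℕ => x ^ n * g * (x ^ n)⁻¹) atTop (𝓝 1) := Iff.rfl

theorem con_conj (t x : G) : con (t * x * t⁻¹) = conjSubgroup t (con x) := by
  ext g
  rw [mem_conjSubgroup, mem_con, mem_con]
  have hc : ∀ s : G, Continuous fun g : G => s * g * s⁻¹ := fun s => by fun_prop
  constructor
  · intro h
    have := ((hc t⁻¹).tendsto' 1 1 (by simp)).comp h
    refine this.congr fun n => ?_
    simp only [Function.comp_apply, conj_pow]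
    group
  · intro h
    have := ((hc t).tendsto' 1 1 (by simp)).comp h
    refine this.congr fun n => ?_
    simp only [Function.comp_apply, conj_pow]
    group

theorem con_pow (x : G) {m : ℕ} (hm : 0 < m) : con (x ^ m) = con x := by
  ext g
  rw [mem_con, mem_con]
  constructor
  · intro h
    rw [tendsto_def]
    intro O hO
    have hfin : ∀ᶠ g in 𝓝 (1 : G), ∀ c ∈ (fun r => x ^ r) '' Set.Iio m, c * g * c⁻¹ ∈ O :=
      eventually_forall_conj_mem ((Set.finite_Iio m).image _).isCompact hO
    obtain ⟨Q, hQ⟩ := eventually_atTop.1 (h.eventually hfin)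
    refine eventually_atTop.2 ⟨m * Q, fun n hn => ?_⟩
    -- Write `n = m q + r` with `r < m`; conjugation by the finitely many `xʳ` is harmless.
    have := hQ (n / m) ((Nat.le_div_iff_mul_le hm).2 (by rwa [mul_comm])) _
      ⟨n % m, Nat.mod_lt n hm, rfl⟩
    have hx : x ^ n = x ^ (n % m) * (x ^ m) ^ (n / m) := by
      rw [← pow_mul, ← pow_add, Nat.mod_add_div]
    simpa [hx, mul_assoc] using this
  · intro h
    refine (h.comp (tendsto_id.const_mul_atTop' hm)).congr fun n => ?_
    simp [pow_mul]

/-- Since `z` normalizes `K`, the powers of an element `y ∈ z K` satisfy `yⁿ ∈ K zⁿ`; conjugation by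
elements of the compact set `K` is equicontinuous at `1`. -/
theorem con_le_con_of_mem_normalized {K : Subgroup G} (hK : IsCompact (K : Set G)) {z y : G}
    (hz : ∀ k ∈ K, z * k * z⁻¹ ∈ K) (hy : z⁻¹ * y ∈ K) : con z ≤ con y := by
  have hpow : ∀ n : ℕ, y ^ n * (z ^ n)⁻¹ ∈ K := by
    intro n
    induction n with
    | zero => simp
    | succ n ih =>
      have : y ^ (n + 1) * (z ^ (n + 1))⁻¹ = z * (z⁻¹ * y * (y ^ n * (z ^ n)⁻¹)) * z⁻¹ := by
        rw [pow_succ', pow_succ']; group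
      rw [this]
      exact hz _ (mul_mem hy ih)
  intro g hg
  rw [mem_con, tendsto_def]
  intro O hO
  filter_upwards [(mem_con.1 hg).eventually (eventually_forall_conj_mem hK hO)] with n hn
  have := hn _ (hpow n)
  simpa [mul_assoc] using this

theorem con_eq_con_of_mem_normalized {K : Subgroup G} (hK : IsCompact (K : Set G)) {z y : G}
    (hz : ∀ k ∈ K, z * k * z⁻¹ ∈ K) (hy : z⁻¹ * y ∈ K) : con y = con z := by
  refine le_antisymm (con_le_con_of_mem_normalized hK (fun k hk => ?_) ?_)
    (con_le_con_of_mem_normalized hK hz hy)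
  · have := hz _ (mul_mem (mul_mem hy hk) (inv_mem hy))
    simpa [mul_assoc] using this
  · simpa using inv_mem hy

/-! ### Elements of scale one -/

theorem scale_eq_one_iff {x : G} : scale x = 1 ↔
    ∃ V : Subgroup G, IsCompact (V : Set G) ∧ IsOpen (V : Set G) ∧ conjSubgroup x V ≤ V := by
  constructor
  · intro h
    have hne : {k : ℕ | ∃ V : Subgroup G, IsCompact (V : Set G) ∧ IsOpen (V : Set G) ∧
        k = (conjSubgroup x V ⊓ V).relIndex (conjSubgroup x V)}.Nonempty := by
      refine Set.nonempty_iff_ne_empty.2 fun he => ?_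
      rw [scale, he, Nat.sInf_empty] at h
      exact zero_ne_one h
    obtain ⟨V, hVc, hVo, hV⟩ := Nat.sInf_mem hne
    refine ⟨V, hVc, hVo, ?_⟩
    have h1 : (conjSubgroup x V ⊓ V).relIndex (conjSubgroup x V) = 1 := hV.symm.trans h
    exact (Subgroup.relIndex_eq_one.1 h1).trans inf_le_right
  · rintro ⟨V, hVc, hVo, hV⟩
    refine le_antisymm (Nat.sInf_le ⟨V, hVc, hVo, ?_⟩) (Nat.one_le_iff_ne_zero.2 fun h0 => ?_)
    · exact (Subgroup.relIndex_eq_one.2 (le_inf le_rfl hV)).symm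
    · -- The indices are nonzero because an open subgroup of a compact group has finite index.
      rcases Nat.sInf_eq_zero.1 h0 with ⟨W, hWc, hWo, hW⟩ | he
      · have : CompactSpace (conjSubgroup x W) :=
          isCompact_iff_compactSpace.1 (isCompact_conjSubgroup x hWc)
        have : Finite (conjSubgroup x W ⧸ (conjSubgroup x W ⊓ W).subgroupOf (conjSubgroup x W)) :=
          Subgroup.quotient_finite_of_isOpen _
            (((isOpen_conjSubgroup x hWo).inter hWo).preimage continuous_subtype_val)
        have := Subgroup.finiteIndex_of_finite_quotient
          (H := (conjSubgroup x W ⊓ W).subgroupOf (conjSubgroup x W))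
        exact this.index_ne_zero hW.symm
      · exact Set.eq_empty_iff_forall_notMem.1 he _ ⟨V, hVc, hVo, rfl⟩

theorem scale_eq_one_conj {x : G} (h : scale x = 1) (t : G) : scale (t * x * t⁻¹) = 1 := by
  obtain ⟨V, hVc, hVo, hV⟩ := scale_eq_one_iff.1 h
  refine scale_eq_one_iff.2
    ⟨conjSubgroup t V, isCompact_conjSubgroup t hVc, isOpen_conjSubgroup t hVo, fun g hg => ?_⟩
  simp only [mem_conjSubgroup] at hg ⊢
  refine hV (mem_conjSubgroup.2 ?_)
  simpa [mul_assoc] using hg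

/-- If `z⁻¹ K z ≤ K` and `y V y⁻¹ ≤ V` for some `y ∈ z K`, then the intersection of the conjugates
of `V` under `K` witnesses that `z` has scale one. -/
theorem scale_eq_one_of_mem_normalized {K : Subgroup G} (hK : IsCompact (K : Set G)) {z y : G}
    (hz : ∀ k ∈ K, z⁻¹ * k * z ∈ K) (hy : z⁻¹ * y ∈ K) (h : scale y = 1) : scale z = 1 := by
  obtain ⟨V, hVc, hVo, hV⟩ := scale_eq_one_iff.1 h
  let W : Subgroup G := ⨅ k : K, conjSubgroup (k : G) V
  have hW : ∀ g, g ∈ W ↔ ∀ k ∈ K, k⁻¹ * g * k ∈ V := fun g => by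
    simp [W, Subgroup.mem_iInf, mem_conjSubgroup]
  have hWV : W ≤ V := fun g hg => by simpa using (hW g).1 hg 1 (one_mem _)
  have hWo : IsOpen (W : Set G) := by
    refine W.isOpen_of_mem_nhds (g := 1) ?_
    filter_upwards [eventually_forall_conj_mem hK (hVo.mem_nhds (one_mem V))] with g hg
    exact (hW g).2 fun k hk => by simpa using hg k⁻¹ (inv_mem hk)
  refine scale_eq_one_iff.2 ⟨W, hVc.of_isClosed_subset (W.isClosed_of_isOpen hWo) hWV, hWo,
    fun g hg => (hW g).2 fun k hk => hV (mem_conjSubgroup.2 ?_)⟩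
  have := (hW _).1 (mem_conjSubgroup.1 hg) (z⁻¹ * k * z * (z⁻¹ * y))
    (mul_mem (hz k hk) hy)
  simpa [mul_assoc] using this

/-- If `xᵐ⁺¹ V x⁻ᵐ⁻¹ ≤ V`, then `x` maps `⋂ i ≤ m, xⁱ V x⁻ⁱ` into itself under conjugation. -/
theorem scale_eq_one_of_pow {x : G} {m : ℕ} (hm : 0 < m) (h : scale (x ^ m) = 1) :
    scale x = 1 := by
  obtain ⟨V, hVc, hVo, hV⟩ := scale_eq_one_iff.1 h
  have hVcl := V.isClosed_of_isOpen hVo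
  obtain ⟨m, rfl⟩ := Nat.exists_eq_succ_of_ne_zero hm.ne'
  refine scale_eq_one_iff.2 ⟨truncCore x V m,
    hVc.of_isClosed_subset (isClosed_truncCore x hVcl m) (truncCore_le x V m),
    isOpen_truncCore x hVo m, fun g hg => mem_truncCore.2 fun i hi => ?_⟩
  have hg' := mem_truncCore.1 (mem_conjSubgroup.1 hg)
  cases i with
  | zero =>
    -- `g ∈ xᵐ⁺¹ V x⁻ᵐ⁻¹`, which is contained in `V`.
    have := hg' m le_rfl
    have h2 : g ∈ conjSubgroup (x ^ (m + 1)) V :=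
      mem_conjSubgroup.2 (by simpa [pow_succ', mul_assoc] using this)
    simpa using hV h2
  | succ i => simpa [pow_succ', mul_assoc] using hg' i (by omega)

end Topological

/-! ### Recurrence in `G ⧸ H` -/

section Covolume

variable {G : Type*} [Group G] [TopologicalSpace G] [IsTopologicalGroup G]

/-- Poincaré recurrence for the action of `x` on `G ⧸ H`, applied to the image of `U`. -/
theorem HasFiniteCovolume.exists_pow_mem {H : Subgroup G} (hH : HasFiniteCovolume H)
    {U : Subgroup G} (hU : IsOpen (U : Set G)) (x : G) :
    ∃ m : ℕ, 0 < m ∧ ∃ a ∈ U, ∃ b ∈ U, a * x ^ m * b ∈ H := by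
  obtain ⟨_, _, μ, _, _, hμ, _⟩ := hH
  let S : Set (G ⧸ H) := QuotientGroup.mk '' (U : Set G)
  have hSo : IsOpen S := QuotientGroup.isOpenMap_coe _ hU
  -- Finitely many translates of `S`, all of the same measure, cover a compact set of positive
  -- measure.
  have hS : μ S ≠ 0 := by
    intro h0
    have hpos : 0 < μ Set.univ := Measure.measure_univ_pos.2 hμ
    obtain ⟨K, -, hK, hKpos⟩ := isOpen_univ.exists_lt_isCompact hpos
    obtain ⟨F, hF⟩ := hK.elim_finite_subcover (fun g : G => g • S) (fun g => hSo.smul g)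
      fun q _ => by
        obtain ⟨g, rfl⟩ := QuotientGroup.mk_surjective q
        exact Set.mem_iUnion.2 ⟨g, Set.mem_smul_set.2 ⟨_, ⟨1, one_mem U, rfl⟩, by simp⟩⟩
    refine hKpos.ne' (measure_mono_null hF ?_)
    refine (measure_biUnion_null_iff F.countable_toSet).2 fun g _ => ?_
    rw [measure_smul, h0]
  obtain ⟨q, ⟨b, hb, rfl⟩, m, hm, a, ha, hab⟩ :=
    (measurePreserving_smul x μ).conservative.exists_mem_iterate_mem
      hSo.measurableSet.nullMeasurableSet hS
  refine ⟨m, Nat.pos_of_ne_zero hm, a⁻¹, inv_mem ha, b, hb, ?_⟩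
  rw [smul_iterate] at hab
  have := QuotientGroup.eq.1 (hab : (a : G ⧸ H) = ((x ^ m * b : G) : G ⧸ H))
  simpa [mul_assoc] using this

/-- Every `x` has a positive power `xᵐ` and a compact subgroup `K` normalized by `xᵐ` such that some
conjugate of an element of `H` lies in `xᵐ K`. -/
theorem HasFiniteCovolume.exists_conj_mem_normalized [LocallyCompactSpace G]
    [TotallyDisconnectedSpace G] {H : Subgroup G} (hH : HasFiniteCovolume H) (x : G) :
    ∃ m : ℕ, 0 < m ∧ ∃ K : Subgroup G, IsCompact (K : Set G) ∧
      (∀ k ∈ K, x ^ m * k * (x ^ m)⁻¹ ∈ K) ∧ (∀ k ∈ K, (x ^ m)⁻¹ * k * x ^ m ∈ K) ∧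
      ∃ h ∈ H, ∃ t : G, (x ^ m)⁻¹ * (t * h * t⁻¹) ∈ K := by
  obtain ⟨U, hUc, hUo, hU⟩ := exists_isTidyAbove x
  have hUcl := U.isClosed_of_isOpen hUo
  obtain ⟨m, hm, a, ha, b, hb, hab⟩ := hH.exists_pow_mem hUo x
  obtain ⟨t, ht⟩ := (hU.pow m).exists_conj_mem_bicore hUc hUcl ha hb
  refine ⟨m, hm, bicore (x ^ m) U,
    hUc.of_isClosed_subset (isClosed_bicore _ hUcl) (bicore_le _ _),
    fun k hk => mul_mul_inv_mem_bicore hk, fun k hk => ?_, _, hab, t, ht⟩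
  have hswap : bicore (x ^ m)⁻¹ U = bicore (x ^ m) U := by
    rw [bicore, bicore, inv_inv, inf_comm]
  rw [← hswap] at hk ⊢
  simpa using mul_mul_inv_mem_bicore hk

end Covolume

end TDLC

theorem corollary2p5 {G : Type*} [Group G] [TopologicalSpace G] [IsTopologicalGroup G]
    [LocallyCompactSpace G] [TotallyDisconnectedSpace G]
    (H : Subgroup G) (hclosed : IsClosed (H : Set G)) (hcovol : TDLC.HasFiniteCovolume H) :
    ((∀ h ∈ H, TDLC.scale h = 1) → TDLC.IsUniscalar G) ∧
    ((∀ h ∈ H, IsClosed (TDLC.con h : Set G)) → ∀ x : G, IsClosed (TDLC.con x : Set G)) ∧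
    ((∀ h ∈ H, TDLC.con h = ⊥) → TDLC.IsAnisotropic G) := by
  have hcon : ∀ x : G, ∃ h ∈ H, ∃ t : G,
      TDLC.con x = TDLC.conjSubgroup t (TDLC.con h) := by
    intro x
    obtain ⟨m, hm, K, hK, hz, -, h, hh, t, ht⟩ := hcovol.exists_conj_mem_normalized x
    refine ⟨h, hh, t, ?_⟩
    rw [← TDLC.con_conj, TDLC.con_eq_con_of_mem_normalized hK hz ht, TDLC.con_pow x hm]
  refine ⟨fun hs x => ?_, fun hc x => ?_, fun hb x => ?_⟩
  · obtain ⟨m, hm, K, hK, -, hz, h, hh, t, ht⟩ := hcovol.exists_conj_mem_normalized x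
    exact TDLC.scale_eq_one_of_pow hm
      (TDLC.scale_eq_one_of_mem_normalized hK hz ht (TDLC.scale_eq_one_conj (hs h hh) t))
  · obtain ⟨h, hh, t, hx⟩ := hcon x
    rw [hx]
    exact TDLC.isClosed_conjSubgroup t (hc h hh)
  · obtain ⟨h, hh, t, hx⟩ := hcon x
    rw [hx, hb h hh]
    exact Subgroup.map_bot _
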